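/- For real $a,b>0$ with $a\neq b$ let $$N(a,b)=\frac{a-b}{2\operatorname{arcsinh}\frac{a-b}{a+b}}$$ be the Neuman–Sándor mean, and for $p\in\mathbb{R}$ let $A_p(a,b)=\left(\frac{a^p+b^p}{2}\right)^{1/p}$ if $p\neq 0$ and $A_0(a,b)=\sqrt{ab}$ be the power mean of order $p$. Put $$p_0=\frac{\ln 2}{\ln\ln(3+2\sqrt2)} .$$ (i) For every $p\in\mathbb{R}$, the inequality $N(a,b)>A_p(a,b)$ holds for all $a,b>0$ with $a\neq b$ if and only if $p\le p_0$; moreover $p_0=1.2228$ rounded to four decimals, that is, $|p_0-1.2228|<0.00005$. (ii) For all $a,b>0$ with $a\ne b$, $$\alpha_2A_{p_0}(a,b)<N(a,b)\le\beta_2A_{p_0}(a,b),$$ where $\alpha_2=1$ and a real number $\beta_2$ with $|\beta_2-1.0138|<0.00005$ are the best possible constants: $\alpha_2=1$ is the largest $\alpha$ such that $\alpha A_{p_0}(a,b)<N(a,b)$ for all $a,b>0$ with $a\neq b$, and $\beta_2$ is the smallest $\beta$ such that $N(a,b)\le\beta A_{p_0}(a,b)$ for all $a,b>0$ with $a\neq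 b$. The upper inequality is strict except for a single ratio: there is $x_0\in(0,1)$ such that, for $a,b>0$ with $a\ne b$, $N(a,b)=\beta_2A_{p_0}(a,b)$ if and only if $b=x_0a$ or $a=x_0b$. -/

import Mathlib

/-- The Neuman-Sandor mean `N(a,b) = (a - b) / (2 arsinh ((a - b) / (a + b)))`,
used for positive `a ≠ b`. -/
noncomputable def neumanSandorMean (a b : ℝ) : ℝ :=
  (a - b) / (2 * Real.arsinh ((a - b) / (a + b)))

/-- The power mean of order `r` of `a` and `b`, used for positive `a`, `b`;
the order `0` is the geometric mean. -/
noncomputable def powerMean (r a b : ℝ) : ℝ :=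
  if r = 0 then √(a * b) else ((a ^ r + b ^ r) / 2) ^ (1 / r)

/-- The sharp order `p₀ = ln 2 / ln ln (3 + 2√2)`. -/
noncomputable def sharpOrder : ℝ :=
  Real.log 2 / Real.log (Real.log (3 + 2 * √2))

/-!
With `a = c e ^ s`, `b = c e ^ (-s)`, `s > 0`, the arguments of `N(a, b)` become `tanh s`, and
`N(a, b) / A_p(a, b) = exp (F s)`, where `F = logRatio p` is
`log (sinh s) - log (arsinh (tanh s)) - log (cosh (p s)) / p` (`neumanSandorMean_eq`). So everything
is a question about the shape of `F` on `(0, ∞)`.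

The limit of `F` at `0` is `0`, and its limit at infinity is `log 2 / p - log (log (3 + 2 √2))`,
which vanishes exactly for `p = sharpOrder` and is negative for larger `p`. This gives the necessity
of `p ≤ sharpOrder` and the optimality of the constant `1`; smaller orders reduce to `sharpOrder` by
the monotonicity of power means.

For `p` near `sharpOrder` the function `F` increases up to a point `m` and decreases afterwards.
Indeed `F'` is a positive multiple of `criticalFun q` with `q = p - 1`, whose derivative is a
positive multiple of the exponential sum `coshSum q`. The sum and its first three derivatives at `0`
are nonnegative, and its fourth derivative is negative. A function with a nonnegative limit at `0`
whose derivative changes sign at most once, from plus to minus, has the same sign pattern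
(`CrossesDown.of_deriv`). Applied four times, then to `criticalFun q`, this shows that `F'` changes
sign only once. Since `F` tends to `0` at both ends, `F > 0` for `p = sharpOrder`, and the best upper
constant is `exp (F m)`, attained only at `b / a = e ^ (-2 m)` and its inverse.

The numerical value follows by enclosing `m` between `bracketLeft` and `bracketRight`, where `F'` has
opposite signs, evaluating `F` at the left end, and bounding `F'` on the short interval between.
-/

open Filter Topology Set

/-! ### Functions that cross zero at most once, downwards -/

/-- Once `f` is nonpositive at a point of `(0, ∞)`, it is negative at all later points. -/
def CrossesDown (f : ℝ → ℝ) : Prop :=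
  ∀ x y : ℝ, 0 < x → x < y → f x ≤ 0 → f y < 0

/-- If `f` starts from a nonnegative limit, then `f x ≤ 0` forces `f' ≤ 0` somewhere before `x`,
after which `f' < 0`; so the single downward crossing of `f'` is inherited by `f`. -/
theorem CrossesDown.of_deriv {f f' : ℝ → ℝ} {l : ℝ}
    (hf : ∀ x, 0 < x → HasDerivAt f (f' x) x) (hl : 0 ≤ l)
    (hlim : Tendsto f (𝓝[>] 0) (𝓝 l)) (h' : CrossesDown f') : CrossesDown f := by
  intro x y hx hxy hfx
  have key : ∃ ξ, 0 < ξ ∧ ξ < x ∧ f' ξ ≤ 0 := by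
    by_contra! hcon
    have hmono : StrictMonoOn f (Ioc 0 x) := by
      apply strictMonoOn_of_deriv_pos (convex_Ioc 0 x)
      · exact fun z hz => (hf z hz.1).continuousAt.continuousWithinAt
      · intro z hz
        rw [interior_Ioc] at hz
        rw [(hf z hz.1).deriv]
        exact hcon z hz.1 hz.2
    have h1 : f (x / 2) < f x := hmono ⟨by linarith, by linarith⟩ ⟨hx, le_rfl⟩ (by linarith)
    have h2 : l ≤ f (x / 2) := by
      refine le_of_tendsto hlim ?_
      filter_upwards [Ioo_mem_nhdsGT (show (0 : ℝ) < x / 2 by linarith)] with z hz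
      exact (hmono ⟨hz.1, by linarith [hz.2]⟩ ⟨by linarith, by linarith⟩ hz.2).le
    linarith
  obtain ⟨ξ, hξ0, hξx, hξ⟩ := key
  have hanti : StrictAntiOn f (Icc x y) := by
    apply strictAntiOn_of_deriv_neg (convex_Icc x y)
    · exact fun z hz => (hf z (hx.trans_le hz.1)).continuousAt.continuousWithinAt
    · intro z hz
      rw [interior_Icc] at hz
      rw [(hf z (hx.trans hz.1)).deriv]
      exact h' ξ z hξ0 (hξx.trans hz.1) hξ
  exact (hanti ⟨le_rfl, hxy.le⟩ ⟨hxy.le, le_rfl⟩ hxy).trans_le hfx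

theorem CrossesDown.of_deriv_of_continuous {f f' : ℝ → ℝ}
    (hf : ∀ x, HasDerivAt f (f' x) x) (h0 : 0 ≤ f 0) (h' : CrossesDown f') : CrossesDown f :=
  CrossesDown.of_deriv (fun x _ => hf x) h0
    ((hf 0).continuousAt.tendsto.mono_left nhdsWithin_le_nhds) h'

/-- Multiplying by a positive function does not change the sign pattern. -/
theorem CrossesDown.of_pos_mul {f w : ℝ → ℝ} (hw : ∀ x, 0 < x → 0 < w x) (hf : CrossesDown f) :
    CrossesDown (fun x => w x * f x) := by
  intro x y hx hxy h
  exact mul_neg_of_pos_of_neg (hw y (hx.trans hxy))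
    (hf x y hx hxy (nonpos_of_mul_nonpos_right h (hw x hx)))

/-! ### The sign pattern of the derivative of the logarithmic ratio -/

/-- The exponential sum whose sign is that of the derivative of `criticalFun q`. -/
noncomputable def coshSum (q s : ℝ) : ℝ :=
  (1 + q) * Real.cosh (3 * s) + 2 * Real.cosh ((3 - 2 * q) * s) - q * Real.cosh (5 * s)
    - Real.cosh ((3 + 2 * q) * s) - Real.cosh s - Real.cosh ((1 - 2 * q) * s)

theorem hasDerivAt_cosh_mul (c s : ℝ) :
    HasDerivAt (fun s => Real.cosh (c * s)) (c * Real.sinh (c * s)) s := by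
  simpa [mul_comm] using (((hasDerivAt_id s).const_mul c).cosh)

theorem hasDerivAt_sinh_mul (c s : ℝ) :
    HasDerivAt (fun s => Real.sinh (c * s)) (c * Real.cosh (c * s)) s := by
  simpa [mul_comm] using (((hasDerivAt_id s).const_mul c).sinh)

/-- At `0` the function and its first three derivatives are `0, 0, 16 (1 - 3 q) > 0, 0`, and the
fourth derivative is negative because the hyperbolic cosines of the larger frequencies dominate. -/
theorem crossesDown_coshSum {q : ℝ} (h1 : 0.22275 < q) (h2 : q < 0.22276) :
    CrossesDown (coshSum q) := by
  set a := 3 - 2 * q with ha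
  set b := 3 + 2 * q with hb
  set c := 1 - 2 * q with hc
  have d0 : ∀ s, HasDerivAt (coshSum q) ((1 + q) * (3 * Real.sinh (3 * s))
      + 2 * (a * Real.sinh (a * s)) - q * (5 * Real.sinh (5 * s)) - b * Real.sinh (b * s)
      - 1 * Real.sinh (1 * s) - c * Real.sinh (c * s)) s := by
    intro s
    have := ((((((hasDerivAt_cosh_mul 3 s).const_mul (1 + q)).add
      ((hasDerivAt_cosh_mul a s).const_mul 2)).sub
      ((hasDerivAt_cosh_mul 5 s).const_mul q)).sub (hasDerivAt_cosh_mul b s)).sub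
      (hasDerivAt_cosh_mul 1 s)).sub (hasDerivAt_cosh_mul c s)
    simp only [one_mul] at this ⊢
    exact this
  have d1 : ∀ s, HasDerivAt (fun s => (1 + q) * (3 * Real.sinh (3 * s))
      + 2 * (a * Real.sinh (a * s)) - q * (5 * Real.sinh (5 * s)) - b * Real.sinh (b * s)
      - 1 * Real.sinh (1 * s) - c * Real.sinh (c * s))
      ((1 + q) * (3 * (3 * Real.cosh (3 * s)))
      + 2 * (a * (a * Real.cosh (a * s))) - q * (5 * (5 * Real.cosh (5 * s)))
      - b * (b * Real.cosh (b * s))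
      - 1 * (1 * Real.cosh (1 * s)) - c * (c * Real.cosh (c * s))) s := fun s =>
    (((((((hasDerivAt_sinh_mul 3 s).const_mul 3).const_mul (1 + q)).add
      (((hasDerivAt_sinh_mul a s).const_mul a).const_mul 2)).sub
      (((hasDerivAt_sinh_mul 5 s).const_mul 5).const_mul q)).sub
      ((hasDerivAt_sinh_mul b s).const_mul b)).sub
      ((hasDerivAt_sinh_mul 1 s).const_mul 1)).sub ((hasDerivAt_sinh_mul c s).const_mul c)
  have d2 : ∀ s, HasDerivAt (fun s => (1 + q) * (3 * (3 * Real.cosh (3 * s)))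
      + 2 * (a * (a * Real.cosh (a * s))) - q * (5 * (5 * Real.cosh (5 * s)))
      - b * (b * Real.cosh (b * s))
      - 1 * (1 * Real.cosh (1 * s)) - c * (c * Real.cosh (c * s)))
      ((1 + q) * (3 * (3 * (3 * Real.sinh (3 * s))))
      + 2 * (a * (a * (a * Real.sinh (a * s)))) - q * (5 * (5 * (5 * Real.sinh (5 * s))))
      - b * (b * (b * Real.sinh (b * s)))
      - 1 * (1 * (1 * Real.sinh (1 * s))) - c * (c * (c * Real.sinh (c * s)))) s := fun s =>
    ((((((((hasDerivAt_cosh_mul 3 s).const_mul 3).const_mul 3).const_mul (1 + q)).add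
      ((((hasDerivAt_cosh_mul a s).const_mul a).const_mul a).const_mul 2)).sub
      ((((hasDerivAt_cosh_mul 5 s).const_mul 5).const_mul 5).const_mul q)).sub
      (((hasDerivAt_cosh_mul b s).const_mul b).const_mul b)).sub
      (((hasDerivAt_cosh_mul 1 s).const_mul 1).const_mul 1)).sub
      (((hasDerivAt_cosh_mul c s).const_mul c).const_mul c)
  have d3 : ∀ s, HasDerivAt (fun s => (1 + q) * (3 * (3 * (3 * Real.sinh (3 * s))))
      + 2 * (a * (a * (a * Real.sinh (a * s)))) - q * (5 * (5 * (5 * Real.sinh (5 * s))))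
      - b * (b * (b * Real.sinh (b * s)))
      - 1 * (1 * (1 * Real.sinh (1 * s))) - c * (c * (c * Real.sinh (c * s))))
      ((1 + q) * (3 * (3 * (3 * (3 * Real.cosh (3 * s)))))
      + 2 * (a * (a * (a * (a * Real.cosh (a * s)))))
      - q * (5 * (5 * (5 * (5 * Real.cosh (5 * s)))))
      - b * (b * (b * (b * Real.cosh (b * s))))
      - 1 * (1 * (1 * (1 * Real.cosh (1 * s)))) - c * (c * (c * (c * Real.cosh (c * s))))) s :=
    fun s =>
    (((((((((hasDerivAt_sinh_mul 3 s).const_mul 3).const_mul 3).const_mul 3).const_mul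
      (1 + q)).add
      (((((hasDerivAt_sinh_mul a s).const_mul a).const_mul a).const_mul a).const_mul 2)).sub
      (((((hasDerivAt_sinh_mul 5 s).const_mul 5).const_mul 5).const_mul 5).const_mul q)).sub
      ((((hasDerivAt_sinh_mul b s).const_mul b).const_mul b).const_mul b)).sub
      ((((hasDerivAt_sinh_mul 1 s).const_mul 1).const_mul 1).const_mul 1)).sub
      ((((hasDerivAt_sinh_mul c s).const_mul c).const_mul c).const_mul c)
  refine CrossesDown.of_deriv_of_continuous d0 ?_ <|
    CrossesDown.of_deriv_of_continuous d1 (by simp) <|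
    CrossesDown.of_deriv_of_continuous d2 ?_ <|
    CrossesDown.of_deriv_of_continuous d3 (by simp) ?_
  · simp only [coshSum, mul_zero, Real.cosh_zero]
    linarith
  · simp only [mul_zero, Real.cosh_zero]
    rw [ha, hb, hc]
    nlinarith
  · intro x y hx hxy _
    have hy : 0 < y := hx.trans hxy
    have c1 : Real.cosh (a * y) ≤ Real.cosh (3 * y) := by
      rw [Real.cosh_le_cosh, abs_of_pos (by rw [ha]; nlinarith), abs_of_pos (by linarith)]
      rw [ha]; nlinarith
    have c2 : Real.cosh (3 * y) ≤ Real.cosh (5 * y) := by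
      rw [Real.cosh_le_cosh, abs_of_pos (by linarith), abs_of_pos (by linarith)]
      linarith
    have c3 : Real.cosh (3 * y) ≤ Real.cosh (b * y) := by
      rw [Real.cosh_le_cosh, abs_of_pos (by linarith), abs_of_pos (by rw [hb]; nlinarith)]
      rw [hb]; nlinarith
    have p1 := Real.cosh_pos (3 * y)
    have p2 := Real.cosh_pos (1 * y)
    have p3 := Real.cosh_pos (c * y)
    have a4 : a * (a * (a * a)) ≤ 81 := by
      have : a ≤ 3 := by linarith
      have ha0 : 0 ≤ a := by linarith
      calc a * (a * (a * a)) ≤ 3 * (3 * (3 * 3)) := by gcongr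
        _ = 81 := by norm_num
    have b4 : 130 ≤ b * (b * (b * b)) := by
      have : 3.44 ≤ b := by linarith
      calc (130 : ℝ) ≤ 3.44 * (3.44 * (3.44 * 3.44)) := by norm_num
        _ ≤ b * (b * (b * b)) := by gcongr
    have e1 : 2 * (a * (a * (a * (a * Real.cosh (a * y))))) ≤ 162 * Real.cosh (3 * y) := by
      have := mul_le_mul a4 c1 (Real.cosh_pos _).le (by norm_num)
      linarith
    have e2 : 130 * Real.cosh (3 * y) ≤ b * (b * (b * (b * Real.cosh (b * y)))) := by
      have := mul_le_mul b4 c3 p1.le (by linarith)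
      linarith
    have e3 : q * Real.cosh (3 * y) ≤ q * Real.cosh (5 * y) := by gcongr
    have e4 : 0 ≤ c * (c * (c * (c * Real.cosh (c * y)))) := by
      have : 0 ≤ c := by linarith
      positivity
    nlinarith

/-- The logarithm of the quotient `N(a, b) / A_p(a, b)` at `a = c e ^ s`, `b = c e ^ (-s)`. -/
noncomputable def logRatio (p s : ℝ) : ℝ :=
  Real.log (Real.sinh s) - Real.log (Real.arsinh (Real.tanh s)) - Real.log (Real.cosh (p * s)) / p

/-- The derivative of `logRatio (1 + q)` divided by a positive function (see `logRatioDeriv_eq`).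
The `arsinh` enters only as a separate summand, so that one more differentiation eliminates it. -/
noncomputable def criticalFun (q s : ℝ) : ℝ :=
  Real.arsinh (Real.tanh s) - Real.sinh s * Real.cosh ((1 + q) * s) /
    (Real.cosh s * √(Real.cosh (2 * s)) * Real.cosh (q * s))

theorem arsinh_tanh_pos {s : ℝ} (hs : 0 < s) : 0 < Real.arsinh (Real.tanh s) := by
  rw [Real.arsinh_pos_iff, Real.tanh_eq_sinh_div_cosh]
  exact div_pos (Real.sinh_pos_iff.2 hs) (Real.cosh_pos s)

theorem sqrt_one_add_tanh_sq (s : ℝ) :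
    √(1 + Real.tanh s ^ 2) = √(Real.cosh (2 * s)) / Real.cosh s := by
  rw [Real.tanh_eq_sinh_div_cosh, Real.cosh_two_mul,
    eq_div_iff (Real.cosh_pos s).ne', ← Real.sqrt_sq (Real.cosh_pos s).le,
    ← Real.sqrt_mul (by positivity), Real.sqrt_sq (Real.cosh_pos s).le]
  congr 1
  have := Real.cosh_pos s
  field_simp

theorem hasDerivAt_tanh (s : ℝ) : HasDerivAt Real.tanh (1 / Real.cosh s ^ 2) s := by
  have h := (Real.hasDerivAt_sinh s).div (Real.hasDerivAt_cosh s) (Real.cosh_pos s).ne'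
  have e : Real.tanh = Real.sinh / Real.cosh := by
    funext x
    exact Real.tanh_eq_sinh_div_cosh x
  rw [e]
  refine h.congr_deriv ?_
  rw [← Real.cosh_sq_sub_sinh_sq s]
  ring

theorem hasDerivAt_arsinh_tanh (s : ℝ) :
    HasDerivAt (fun s => Real.arsinh (Real.tanh s))
      (1 / (Real.cosh s * √(Real.cosh (2 * s)))) s := by
  have h := (hasDerivAt_tanh s).arsinh
  convert h using 1
  rw [sqrt_one_add_tanh_sq, smul_eq_mul]
  have := Real.cosh_pos s
  have : 0 < √(Real.cosh (2 * s)) := Real.sqrt_pos.2 (Real.cosh_pos _)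
  field_simp

/-- The numerator of the derivative of `criticalFun q` equals `coshSum q / 8`; an identity of
Laurent polynomials in `exp s` and `exp (q s)`. -/
theorem coshSum_eq (q s : ℝ) :
    coshSum q s = 8 * (Real.cosh s * Real.cosh (2 * s) * Real.cosh (q * s) ^ 2
      - (Real.cosh s * Real.cosh ((1 + q) * s) + Real.sinh s * ((1 + q) * Real.sinh ((1 + q) * s)))
        * (Real.cosh s * Real.cosh (2 * s) * Real.cosh (q * s))
      + Real.sinh s * Real.cosh ((1 + q) * s) *
        ((Real.sinh s * Real.cosh (2 * s) + Real.cosh s * Real.sinh (2 * s)) * Real.cosh (q * s)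
          + Real.cosh s * Real.cosh (2 * s) * (q * Real.sinh (q * s)))) := by
  have e (k l : ℝ) : Real.exp (k * s + l * (q * s)) = Real.exp s ^ k * Real.exp (q * s) ^ l := by
    rw [Real.exp_add, ← Real.exp_mul, ← Real.exp_mul, mul_comm k, mul_comm l]
  simp only [coshSum, Real.cosh_eq, Real.sinh_eq]
  rw [show 3 * s = (3 : ℕ) * s by norm_num, show 5 * s = (5 : ℕ) * s by norm_num,
    show 2 * s = (2 : ℕ) * s by norm_num,
    show (3 - 2 * q) * s = (3 : ℕ) * s - (2 : ℕ) * (q * s) by push_cast; ring,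
    show (3 + 2 * q) * s = (3 : ℕ) * s + (2 : ℕ) * (q * s) by push_cast; ring,
    show (1 - 2 * q) * s = s - (2 : ℕ) * (q * s) by push_cast; ring,
    show (1 + q) * s = s + q * s by ring]
  simp only [Real.exp_neg, Real.exp_sub, Real.exp_add, Real.exp_nat_mul]
  have hX := Real.exp_pos s
  have hY := Real.exp_pos (q * s)
  generalize Real.exp s = X at *
  generalize Real.exp (q * s) = Y at *
  field_simp
  ring

theorem hasDerivAt_criticalFun (q s : ℝ) :
    HasDerivAt (criticalFun q)
      (1 / (8 * (Real.cosh s ^ 2 * √(Real.cosh (2 * s)) ^ 3 * Real.cosh (q * s) ^ 2))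
        * coshSum q s) s := by
  have hC := Real.cosh_pos s
  have hC2 := Real.cosh_pos (2 * s)
  have hR : 0 < √(Real.cosh (2 * s)) := Real.sqrt_pos.2 hC2
  have hq := Real.cosh_pos (q * s)
  have h := (hasDerivAt_arsinh_tanh s).sub
    (((Real.hasDerivAt_sinh s).mul (hasDerivAt_cosh_mul (1 + q) s)).div
    (((Real.hasDerivAt_cosh s).mul ((hasDerivAt_cosh_mul 2 s).sqrt hC2.ne')).mul
      (hasDerivAt_cosh_mul q s)) (by simp only [Pi.mul_apply]; positivity))
  refine HasDerivAt.congr_deriv h ?_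
  rw [coshSum_eq]
  simp only [Pi.mul_apply]
  have hsq : Real.cosh (2 * s) = √(Real.cosh (2 * s)) ^ 2 := (Real.sq_sqrt hC2.le).symm
  generalize √(Real.cosh (2 * s)) = R at *
  rw [hsq]
  field_simp
  ring

theorem criticalFun_zero (q : ℝ) : criticalFun q 0 = 0 := by simp [criticalFun]

theorem crossesDown_criticalFun {q : ℝ} (h1 : 0.22275 < q) (h2 : q < 0.22276) :
    CrossesDown (criticalFun q) := by
  refine CrossesDown.of_deriv_of_continuous (hasDerivAt_criticalFun q) (criticalFun_zero q).ge
    (CrossesDown.of_pos_mul (fun s _ => ?_) (crossesDown_coshSum h1 h2))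
  have : 0 < √(Real.cosh (2 * s)) := Real.sqrt_pos.2 (Real.cosh_pos _)
  have := Real.cosh_pos s
  have := Real.cosh_pos (q * s)
  positivity

/-- The derivative of `logRatio p` in `s`. -/
noncomputable def logRatioDeriv (p s : ℝ) : ℝ :=
  1 / Real.tanh s - 1 / (Real.cosh s * √(Real.cosh (2 * s)) * Real.arsinh (Real.tanh s))
    - Real.tanh (p * s)

theorem hasDerivAt_logRatio {p s : ℝ} (hp : p ≠ 0) (hs : 0 < s) :
    HasDerivAt (logRatio p) (logRatioDeriv p s) s := by
  have hS : 0 < Real.sinh s := Real.sinh_pos_iff.2 hs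
  have hA := arsinh_tanh_pos hs
  have h := (((Real.hasDerivAt_sinh s).log hS.ne').sub
    ((hasDerivAt_arsinh_tanh s).log hA.ne')).sub
    (((hasDerivAt_cosh_mul p s).log (Real.cosh_pos (p * s)).ne').div_const p)
  refine HasDerivAt.congr_deriv h ?_
  have := Real.cosh_pos s
  have := Real.cosh_pos (p * s)
  have : 0 < √(Real.cosh (2 * s)) := Real.sqrt_pos.2 (Real.cosh_pos _)
  rw [logRatioDeriv, Real.tanh_eq_sinh_div_cosh (p * s)]
  rw [show 1 / Real.tanh s = Real.cosh s / Real.sinh s by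
    rw [Real.tanh_eq_sinh_div_cosh, one_div_div]]
  field_simp

theorem logRatioDeriv_eq (q : ℝ) {s : ℝ} (hs : 0 < s) :
    logRatioDeriv (1 + q) s = Real.cosh (q * s) /
      (Real.sinh s * Real.cosh ((1 + q) * s) * Real.arsinh (Real.tanh s)) * criticalFun q s := by
  have hS : 0 < Real.sinh s := Real.sinh_pos_iff.2 hs
  have hA := arsinh_tanh_pos hs
  have := Real.cosh_pos s
  have := Real.cosh_pos (q * s)
  have := Real.cosh_pos ((1 + q) * s)
  have : 0 < √(Real.cosh (2 * s)) := Real.sqrt_pos.2 (Real.cosh_pos _)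
  have e : Real.cosh (q * s) = Real.cosh ((1 + q) * s) * Real.cosh s
      - Real.sinh ((1 + q) * s) * Real.sinh s := by
    rw [← Real.cosh_sub]
    ring_nf
  have e' : 1 / Real.tanh s - Real.tanh ((1 + q) * s) =
      Real.cosh (q * s) / (Real.sinh s * Real.cosh ((1 + q) * s)) := by
    rw [e, Real.tanh_eq_sinh_div_cosh, Real.tanh_eq_sinh_div_cosh, one_div_div]
    field_simp
  rw [logRatioDeriv, criticalFun, sub_right_comm, e']
  field_simp

theorem crossesDown_logRatioDeriv {p : ℝ} (h1 : 1.22275 < p) (h2 : p < 1.22276) :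
    CrossesDown (logRatioDeriv p) := by
  have hc := crossesDown_criticalFun (q := p - 1) (by norm_num at *; linarith)
    (by norm_num at *; linarith)
  have hw : CrossesDown _ := hc.of_pos_mul (w := fun s => Real.cosh ((p - 1) * s) /
    (Real.sinh s * Real.cosh ((1 + (p - 1)) * s) * Real.arsinh (Real.tanh s))) (fun s hs => by
      have := Real.sinh_pos_iff.2 hs
      have := arsinh_tanh_pos hs
      have := Real.cosh_pos ((p - 1) * s)
      have := Real.cosh_pos ((1 + (p - 1)) * s)
      positivity)
  intro x y hx hxy h
  have e := fun s (hs : 0 < s) => logRatioDeriv_eq (p - 1) hs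
  simp only [add_sub_cancel] at e hw
  rw [e x hx] at h
  rw [e y (hx.trans hxy)]
  exact hw x y hx hxy h

/-! ### Boundary behaviour of the logarithmic ratio -/

theorem tendsto_logRatio_zero (p : ℝ) : Tendsto (logRatio p) (𝓝[>] 0) (𝓝 0) := by
  have h1 := (Real.hasDerivAt_sinh 0).tendsto_slope_zero_right
  have h2 := (hasDerivAt_arsinh_tanh 0).tendsto_slope_zero_right
  simp only [zero_add, Real.sinh_zero, Real.tanh_zero, Real.arsinh_zero, sub_zero, smul_eq_mul,
    Real.cosh_zero, mul_zero, Real.sqrt_one, mul_one, div_one] at h1 h2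
  have h3 : Tendsto (fun s => Real.log (Real.cosh (p * s)) / p) (𝓝[>] 0) (𝓝 0) := by
    have : ContinuousAt (fun s => Real.log (Real.cosh (p * s)) / p) 0 :=
      ((hasDerivAt_cosh_mul p 0).continuousAt.log (Real.cosh_pos _).ne').div_const p
    have := this.tendsto.mono_left (nhdsWithin_le_nhds (s := Ioi 0))
    simpa using this
  have h4 := ((h1.log one_ne_zero).sub (h2.log one_ne_zero)).sub h3
  simp only [Real.log_one, sub_zero] at h4
  refine h4.congr' ?_
  filter_upwards [self_mem_nhdsWithin] with s hs
  have hs : 0 < s := hs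
  rw [logRatio, Real.log_mul (inv_pos.2 hs).ne' (Real.sinh_pos_iff.2 hs).ne',
    Real.log_mul (inv_pos.2 hs).ne' (arsinh_tanh_pos hs).ne']
  ring

theorem log_cosh_eq (s : ℝ) :
    Real.log (Real.cosh s) = s + Real.log (1 + Real.exp (-2 * s)) - Real.log 2 := by
  have : Real.cosh s = Real.exp s * (1 + Real.exp (-2 * s)) / 2 := by
    rw [mul_add, ← Real.exp_add, Real.cosh_eq]
    ring_nf
  rw [this, Real.log_div (by positivity) two_ne_zero, Real.log_mul (by positivity) (by positivity),
    Real.log_exp]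

theorem log_sinh_eq {s : ℝ} (hs : 0 < s) :
    Real.log (Real.sinh s) = s + Real.log (1 - Real.exp (-2 * s)) - Real.log 2 := by
  have h : Real.exp (-2 * s) < 1 := by
    rw [← Real.exp_zero, Real.exp_lt_exp]
    linarith
  have : Real.sinh s = Real.exp s * (1 - Real.exp (-2 * s)) / 2 := by
    rw [mul_sub, ← Real.exp_add, Real.sinh_eq]
    ring_nf
  rw [this, Real.log_div (mul_pos (Real.exp_pos s) (by linarith)).ne' two_ne_zero,
    Real.log_mul (by positivity) (by linarith), Real.log_exp]

theorem log_three_add : Real.log (3 + 2 * √2) = 2 * Real.arsinh 1 := by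
  rw [Real.arsinh, show (3 + 2 * √2 : ℝ) = (1 + √(1 + 1 ^ 2)) ^ 2 by
    have : √(2 : ℝ) ^ 2 = 2 := Real.sq_sqrt (by norm_num)
    norm_num
    nlinarith, Real.log_pow]
  norm_num

theorem tendsto_logRatio_atTop {p : ℝ} (hp : 0 < p) :
    Tendsto (logRatio p) atTop
      (𝓝 (Real.log 2 / p - Real.log (Real.log (3 + 2 * √2)))) := by
  have hexp (k : ℝ) (hk : 0 < k) : Tendsto (fun s : ℝ => Real.exp (-2 * (k * s))) atTop (𝓝 0) := by
    have h := tendsto_id.const_mul_atTop_of_neg (show -2 * k < 0 by linarith)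
    exact (Real.tendsto_exp_atBot.comp h).congr fun s => by simp [mul_assoc]
  have hs := ((hexp 1 one_pos).const_sub 1).log (by norm_num)
  have hc := ((hexp p hp).const_add 1).log (by norm_num)
  have ht : Tendsto Real.tanh atTop (𝓝 1) := by
    have := ((hexp 1 one_pos).const_sub 1).div ((hexp 1 one_pos).const_add 1) (by norm_num)
    simp only [sub_zero, add_zero, div_one, one_mul] at this
    refine this.congr fun s => ?_
    have e : Real.exp (-2 * s) = Real.exp (-s) * Real.exp (-s) := by
      rw [← Real.exp_add]; ring_nf
    have e' : Real.exp s * Real.exp (-s) = 1 := by rw [← Real.exp_add]; simp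
    have := Real.exp_pos s
    have := Real.exp_pos (-s)
    rw [Pi.div_apply, Real.tanh_eq_sinh_div_cosh, Real.sinh_eq, Real.cosh_eq, e,
      div_div_div_cancel_right₀ two_ne_zero, div_eq_div_iff (by positivity) (by positivity)]
    linear_combination (-2 * Real.exp (-s)) * e'
  have hA := (ht.arsinh).log (Real.arsinh_pos_iff.2 one_pos).ne'
  have h := ((hs.sub_const (Real.log 2)).sub hA).sub ((hc.sub_const (Real.log 2)).div_const p)
  have hlim : Real.log (1 - 0) - Real.log 2 - Real.log (Real.arsinh 1)
      - (Real.log (1 + 0) - Real.log 2) / p =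
      Real.log 2 / p - Real.log (Real.log (3 + 2 * √2)) := by
    rw [log_three_add, Real.log_mul two_ne_zero (Real.arsinh_pos_iff.2 one_pos).ne']
    simp
    ring
  rw [hlim] at h
  refine h.congr' ?_
  filter_upwards [eventually_gt_atTop 0] with s hs
  rw [logRatio, log_cosh_eq, log_sinh_eq hs, one_mul]
  field_simp
  ring

/-! ### The means in hyperbolic coordinates -/

theorem neumanSandorMean_comm (a b : ℝ) : neumanSandorMean a b = neumanSandorMean b a := by
  rw [neumanSandorMean, neumanSandorMean, show (b - a) / (b + a) = -((a - b) / (a + b)) by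
    rw [add_comm b a]; ring, Real.arsinh_neg, mul_neg, ← neg_sub a b, neg_div_neg_eq]

theorem powerMean_comm (p a b : ℝ) : powerMean p a b = powerMean p b a := by
  rw [powerMean, powerMean, mul_comm a b, add_comm (a ^ p)]

theorem exists_hyperbolic_coordinates {a b : ℝ} (hb : 0 < b) (hab : b < a) :
    ∃ c s : ℝ, 0 < c ∧ 0 < s ∧ a = c * Real.exp s ∧ b = c * Real.exp (-s) := by
  have ha : 0 < a := hb.trans hab
  refine ⟨Real.exp ((Real.log a + Real.log b) / 2), (Real.log a - Real.log b) / 2,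
    Real.exp_pos _, ?_, ?_, ?_⟩
  · linarith [Real.log_lt_log hb hab]
  · rw [← Real.exp_add, ← add_div, add_add_sub_cancel, add_self_div_two, Real.exp_log ha]
  · rw [← Real.exp_add, show (Real.log a + Real.log b) / 2 + -((Real.log a - Real.log b) / 2)
      = Real.log b by ring, Real.exp_log hb]

theorem powerMean_eq {p c : ℝ} (hp : p ≠ 0) (hc : 0 < c) (s : ℝ) :
    powerMean p (c * Real.exp s) (c * Real.exp (-s)) =
      c * Real.exp (Real.log (Real.cosh (p * s)) / p) := by
  have e : ((c * Real.exp s) ^ p + (c * Real.exp (-s)) ^ p) / 2 = c ^ p * Real.cosh (p * s) := by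
    rw [Real.mul_rpow hc.le (Real.exp_pos _).le, Real.mul_rpow hc.le (Real.exp_pos _).le,
      ← Real.exp_mul, ← Real.exp_mul, Real.cosh_eq, mul_comm s p, neg_mul, mul_comm s p]
    ring
  rw [powerMean, if_neg hp, e, Real.mul_rpow (by positivity) (Real.cosh_pos _).le,
    ← Real.rpow_mul hc.le, mul_one_div_cancel hp, Real.rpow_one,
    Real.rpow_def_of_pos (Real.cosh_pos _), mul_one_div]

theorem powerMean_zero_eq {c : ℝ} (hc : 0 < c) (s : ℝ) :
    powerMean 0 (c * Real.exp s) (c * Real.exp (-s)) = c := by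
  rw [powerMean, if_pos rfl, mul_mul_mul_comm, ← Real.exp_add, add_neg_cancel, Real.exp_zero,
    mul_one, Real.sqrt_mul_self hc.le]

theorem powerMean_pos {p c : ℝ} (hp : p ≠ 0) (hc : 0 < c) (s : ℝ) :
    0 < powerMean p (c * Real.exp s) (c * Real.exp (-s)) := by
  rw [powerMean_eq hp hc]
  positivity

theorem powerMean_le_powerMean {r p c : ℝ} (hp : 0 < p) (hrp : r ≤ p) (hc : 0 < c) (s : ℝ) :
    powerMean r (c * Real.exp s) (c * Real.exp (-s)) ≤
      powerMean p (c * Real.exp s) (c * Real.exp (-s)) := by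
  have hlog (k : ℝ) : 0 ≤ Real.log (Real.cosh (k * s)) := Real.log_nonneg (Real.one_le_cosh _)
  rcases lt_trichotomy r 0 with hr | rfl | hr
  · rw [powerMean_eq hr.ne hc, powerMean_eq hp.ne' hc]
    have h1 := div_nonpos_of_nonneg_of_nonpos (hlog r) hr.le
    have h2 := div_nonneg (hlog p) hp.le
    exact mul_le_mul_of_nonneg_left (Real.exp_le_exp.2 (h1.trans h2)) hc.le
  · rw [powerMean_zero_eq hc, powerMean_eq hp.ne' hc]
    exact le_mul_of_one_le_right hc.le (Real.one_le_exp (div_nonneg (hlog p) hp.le))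
  · rw [powerMean_eq hr.ne' hc, powerMean_eq hp.ne' hc]
    refine mul_le_mul_of_nonneg_left (Real.exp_le_exp.2 ?_) hc.le
    have hconv := (convexOn_rpow (one_le_div hr |>.2 hrp)).2
      (Real.exp_pos (r * s)).le (Real.exp_pos (-(r * s))).le
      (show (0 : ℝ) ≤ 1 / 2 by norm_num) (show (0 : ℝ) ≤ 1 / 2 by norm_num) (by norm_num)
    have e1 : r * s * (p / r) = p * s := by field_simp
    simp only [smul_eq_mul, ← Real.exp_mul, neg_mul, e1] at hconv
    have e2 : 1 / 2 * Real.exp (r * s) + 1 / 2 * Real.exp (-(r * s)) = Real.cosh (r * s) := by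
      rw [Real.cosh_eq]; ring
    have e3 : 1 / 2 * Real.exp (p * s) + 1 / 2 * Real.exp (-(p * s)) = Real.cosh (p * s) := by
      rw [Real.cosh_eq]; ring
    rw [e2, e3] at hconv
    have h := Real.log_le_log (Real.rpow_pos_of_pos (Real.cosh_pos _) _) hconv
    rw [Real.log_rpow (Real.cosh_pos _)] at h
    rw [div_le_div_iff₀ hr hp]
    calc _ = p / r * Real.log (Real.cosh (r * s)) * r := by field_simp
      _ ≤ _ := by gcongr

theorem neumanSandorMean_eq {p c s : ℝ} (hp : p ≠ 0) (hc : 0 < c) (hs : 0 < s) :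
    neumanSandorMean (c * Real.exp s) (c * Real.exp (-s)) =
      Real.exp (logRatio p s) * powerMean p (c * Real.exp s) (c * Real.exp (-s)) := by
  have hA := arsinh_tanh_pos hs
  have e : (c * Real.exp s - c * Real.exp (-s)) / (c * Real.exp s + c * Real.exp (-s))
      = Real.tanh s := by
    rw [← mul_sub, ← mul_add, mul_div_mul_left _ _ hc.ne', Real.tanh_eq_sinh_div_cosh,
      Real.sinh_eq, Real.cosh_eq, div_div_div_cancel_right₀ two_ne_zero]
  rw [powerMean_eq hp hc, neumanSandorMean, e, logRatio, Real.exp_sub, Real.exp_sub,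
    Real.exp_log (Real.sinh_pos_iff.2 hs), Real.exp_log hA, Real.sinh_eq]
  field_simp

/-- A symmetric assertion about distinct positive numbers need only be checked on the pairs
`(c e ^ s, c e ^ (-s))` with `c, s > 0`. -/
theorem forall_ne_iff {P : ℝ → ℝ → Prop} (hP : ∀ a b, P a b → P b a) :
    (∀ a b : ℝ, 0 < a → 0 < b → a ≠ b → P a b) ↔
      ∀ c s : ℝ, 0 < c → 0 < s → P (c * Real.exp s) (c * Real.exp (-s)) := by
  constructor
  · intro h c s hc hs
    refine h _ _ (by positivity) (by positivity) fun h => ?_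
    have := Real.exp_lt_exp.2 (show -s < s by linarith)
    exact this.ne' (mul_left_cancel₀ hc.ne' h)
  · intro h a b ha hb hab
    rcases lt_or_gt_of_ne hab with hlt | hlt
    · obtain ⟨c, s, hc, hs, rfl, rfl⟩ := exists_hyperbolic_coordinates ha hlt
      exact hP _ _ (h c s hc hs)
    · obtain ⟨c, s, hc, hs, rfl, rfl⟩ := exists_hyperbolic_coordinates hb hlt
      exact h c s hc hs

/-! ### Numerical bounds -/

open Finset in
/-- Taylor bounds on `[0, 1]`, raised to the fourth power so that they reach arguments up to `4`. -/
theorem exp_four_mul_le {x z : ℝ} (h0 : 0 ≤ x) (h1 : x ≤ 1)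
    (h : (∑ m ∈ range 12, x ^ m / m.factorial + x ^ 12 * (12 + 1) / (Nat.factorial 12 * 12)) ^ 4
      ≤ z) : Real.exp (4 * x) ≤ z := by
  have := Real.exp_bound' h0 h1 (n := 12) (by norm_num)
  rw [show 4 * x = (4 : ℕ) * x by norm_num, Real.exp_nat_mul]
  refine le_trans ?_ h
  gcongr
  exact_mod_cast this

open Finset in
theorem le_exp_four_mul {x z : ℝ} (h0 : 0 ≤ x)
    (h : z ≤ (∑ m ∈ range 12, x ^ m / m.factorial) ^ 4) : z ≤ Real.exp (4 * x) := by
  rw [show 4 * x = (4 : ℕ) * x by norm_num, Real.exp_nat_mul]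
  refine h.trans ?_
  have := Real.sum_le_exp_of_nonneg h0 12
  gcongr

open Finset in
theorem four_mul_le_log {x z : ℝ} (h0 : 0 ≤ x) (h1 : x ≤ 1)
    (h : (∑ m ∈ range 12, x ^ m / m.factorial + x ^ 12 * (12 + 1) / (Nat.factorial 12 * 12)) ^ 4
      ≤ z) : 4 * x ≤ Real.log z :=
  have := exp_four_mul_le h0 h1 h
  (Real.le_log_iff_exp_le ((Real.exp_pos _).trans_le this)).2 this

open Finset in
theorem log_le_four_mul {x z : ℝ} (h0 : 0 ≤ x) (hz : 0 < z)
    (h : z ≤ (∑ m ∈ range 12, x ^ m / m.factorial) ^ 4) : Real.log z ≤ 4 * x :=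
  (Real.log_le_iff_le_exp hz).2 (le_exp_four_mul h0 h)

theorem log_log_bounds : 0.566871 < Real.log (Real.log (3 + 2 * √2)) ∧
    Real.log (Real.log (3 + 2 * √2)) < 0.5668756 := by
  have h1 : 1.41421356 < √(2 : ℝ) := Real.lt_sqrt_of_sq_lt (by norm_num)
  have h2 : √(2 : ℝ) < 1.41421357 := (Real.sqrt_lt' (by norm_num)).2 (by norm_num)
  have l1 : (1.762747 : ℝ) ≤ Real.log (3 + 2 * √2) := by
    refine le_trans ?_ (Real.log_le_log (x := 5.82842712) (by norm_num) (by linarith))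
    refine le_trans (by norm_num) (four_mul_le_log (x := 0.44068675) (by norm_num) (by norm_num) ?_)
    norm_num [Finset.sum_range_succ, Nat.factorial]
  have l2 : Real.log (3 + 2 * √2) ≤ 1.762748 := by
    refine le_trans (Real.log_le_log (y := 5.82842714) (by linarith) (by linarith)) ?_
    refine le_trans (log_le_four_mul (x := 0.440687) (by norm_num) (by norm_num) ?_) (by norm_num)
    norm_num [Finset.sum_range_succ, Nat.factorial]
  constructor
  · refine lt_of_lt_of_le ?_ (Real.log_le_log (by norm_num) l1)
    refine lt_of_lt_of_le (b := 4 * 0.141718) (by norm_num)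
      (four_mul_le_log (by norm_num) (by norm_num) ?_)
    norm_num [Finset.sum_range_succ, Nat.factorial]
  · refine lt_of_le_of_lt (Real.log_le_log (by linarith) l2) ?_
    refine lt_of_le_of_lt (b := 4 * 0.14171885)
      (log_le_four_mul (by norm_num) (by norm_num) ?_) (by norm_num)
    norm_num [Finset.sum_range_succ, Nat.factorial]

theorem sharpOrder_bounds : 1.22275 < sharpOrder ∧ sharpOrder < 1.22276 := by
  obtain ⟨h1, h2⟩ := log_log_bounds
  have := Real.log_two_gt_d9
  have := Real.log_two_lt_d9
  rw [sharpOrder, lt_div_iff₀ (by linarith), div_lt_iff₀ (by linarith)]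
  norm_num at *
  constructor <;> linarith

theorem tanh_eq_one_sub (u : ℝ) : Real.tanh u = 1 - 2 / (Real.exp (2 * u) + 1) := by
  rw [Real.tanh_eq_sinh_div_cosh, Real.sinh_eq, Real.cosh_eq, div_div_div_cancel_right₀ two_ne_zero,
    two_mul, Real.exp_add, Real.exp_neg]
  have := Real.exp_pos u
  field_simp
  ring

theorem log_cosh_eq_half_log (u : ℝ) :
    Real.log (Real.cosh u) = Real.log ((Real.exp (2 * u) + 1 / Real.exp (2 * u) + 2) / 4) / 2 := by
  have : (Real.exp (2 * u) + 1 / Real.exp (2 * u) + 2) / 4 = Real.cosh u ^ 2 := by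
    rw [Real.cosh_eq, two_mul, Real.exp_add, Real.exp_neg]
    have := Real.exp_pos u
    field_simp
    ring
  rw [this, Real.log_pow]
  norm_num

theorem logRatioDeriv_eq_tanh (p s : ℝ) :
    logRatioDeriv p s = 1 / Real.tanh s - (1 - Real.tanh s ^ 2) /
      (√(1 + Real.tanh s ^ 2) * Real.arsinh (Real.tanh s)) - Real.tanh (p * s) := by
  have e : 1 - Real.tanh s ^ 2 = 1 / Real.cosh s ^ 2 := by
    have := Real.cosh_pos s
    have := Real.cosh_sq_sub_sinh_sq s
    rw [Real.tanh_eq_sinh_div_cosh]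
    field_simp
    linarith
  rw [logRatioDeriv, e, sqrt_one_add_tanh_sq]
  have := Real.cosh_pos s
  have : 0 < √(Real.cosh (2 * s)) := Real.sqrt_pos.2 (Real.cosh_pos _)
  congr 2
  field_simp

theorem two_mul_artanh {t : ℝ} (h0 : 0 ≤ t) (h1 : t < 1) :
    2 * Real.artanh t = Real.log ((1 + t) / (1 - t)) := by
  rw [Real.artanh_eq_half_log ⟨by linarith, h1.le⟩]
  ring

/-- Upper bound for `logRatioDeriv p` on an interval, by the monotonicity of its three terms. -/
theorem logRatioDeriv_le {p s₁ s₂ s : ℝ} (hp : 0 < p) (h0 : 0 < s₁) (h1 : s₁ ≤ s) (h2 : s ≤ s₂) :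
    logRatioDeriv p s ≤ 1 / Real.tanh s₁ - (1 - Real.tanh s₂ ^ 2) /
      (√(1 + Real.tanh s₂ ^ 2) * Real.arsinh (Real.tanh s₂)) - Real.tanh (p * s₁) := by
  have hmono : StrictMono Real.tanh := by
    refine strictMono_of_deriv_pos fun x => ?_
    rw [(hasDerivAt_tanh x).deriv]
    have := Real.cosh_pos x
    positivity
  have hpos {x : ℝ} (hx : 0 < x) : 0 < Real.tanh x := by simpa using hmono hx
  have m1 := hmono.monotone h1
  have m2 := hmono.monotone h2
  have m3 : Real.tanh (p * s₁) ≤ Real.tanh (p * s) := hmono.monotone (by gcongr)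
  have q1 := hpos h0
  have q2 := hpos (h0.trans_le h1)
  have q3 := arsinh_tanh_pos (h0.trans_le h1)
  have q4 : Real.tanh s₂ < 1 := Real.tanh_lt_one s₂
  have m4 := Real.arsinh_le_arsinh.2 m2
  rw [logRatioDeriv_eq_tanh]
  refine sub_le_sub (sub_le_sub ?_ ?_) m3
  · gcongr
  · refine div_le_div₀ ?_ ?_ ?_ ?_
    · nlinarith
    · gcongr
    · positivity
    · gcongr

/-- Left end of a bracket of the maximum point of `logRatio p`. It is chosen so that
`tanh bracketLeft = (y - 1 / y) / 2` with `y = 53 / 27`, which makes `√(1 + tanh ^ 2)` rational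
and `arsinh (tanh bracketLeft) = log y`. -/
noncomputable def bracketLeft : ℝ := Real.artanh (1040 / 1431)

/-- Right end of the bracket of the maximum point, chosen as `bracketLeft` but with
`y = 55 / 28`. -/
noncomputable def bracketRight : ℝ := Real.artanh (2241 / 3080)

theorem tanh_bracketLeft : Real.tanh bracketLeft = 1040 / 1431 :=
  Real.tanh_artanh (by norm_num)

theorem tanh_bracketRight : Real.tanh bracketRight = 2241 / 3080 :=
  Real.tanh_artanh (by norm_num)

theorem sqrt_left : √(1 + (1040 / 1431 : ℝ) ^ 2) = 1769 / 1431 := by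
  rw [Real.sqrt_eq_iff_mul_self_eq (by positivity) (by positivity)]
  norm_num

theorem sqrt_right : √(1 + (2241 / 3080 : ℝ) ^ 2) = 3809 / 3080 := by
  rw [Real.sqrt_eq_iff_mul_self_eq (by positivity) (by positivity)]
  norm_num

theorem arsinh_left_bounds : 0.6744548 ≤ Real.arsinh (1040 / 1431) ∧
    Real.arsinh (1040 / 1431) ≤ 0.6744552 := by
  rw [Real.arsinh, sqrt_left]
  constructor
  · refine le_trans (b := 4 * 0.1686137) (by norm_num)
      (four_mul_le_log (by norm_num) (by norm_num) ?_)
    norm_num [Finset.sum_range_succ, Nat.factorial]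
  · refine le_trans (b := 4 * 0.1686138)
      (log_le_four_mul (by norm_num) (by norm_num) ?_) (by norm_num)
    norm_num [Finset.sum_range_succ, Nat.factorial]

theorem arsinh_right_le : Real.arsinh (2241 / 3080) ≤ 0.6751288 := by
  rw [Real.arsinh, sqrt_right]
  refine le_trans (b := 4 * 0.1687822)
    (log_le_four_mul (by norm_num) (by norm_num) ?_) (by norm_num)
  norm_num [Finset.sum_range_succ, Nat.factorial]

theorem bracketLeft_bounds : 1.8436704 ≤ 2 * bracketLeft ∧ 2 * bracketLeft ≤ 1.8436708 := by
  rw [bracketLeft, two_mul_artanh (by norm_num) (by norm_num)]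
  constructor
  · refine le_trans (b := 4 * 0.4609176) (by norm_num)
      (four_mul_le_log (by norm_num) (by norm_num) ?_)
    norm_num [Finset.sum_range_succ, Nat.factorial]
  · refine le_trans (b := 4 * 0.4609177)
      (log_le_four_mul (by norm_num) (by norm_num) ?_) (by norm_num)
    norm_num [Finset.sum_range_succ, Nat.factorial]

theorem bracketRight_bounds : 1.8472056 ≤ 2 * bracketRight ∧ 2 * bracketRight ≤ 1.847206 := by
  rw [bracketRight, two_mul_artanh (by norm_num) (by norm_num)]
  constructor
  · refine le_trans (b := 4 * 0.4618014) (by norm_num)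
      (four_mul_le_log (by norm_num) (by norm_num) ?_)
    norm_num [Finset.sum_range_succ, Nat.factorial]
  · refine le_trans (b := 4 * 0.4618015)
      (log_le_four_mul (by norm_num) (by norm_num) ?_) (by norm_num)
    norm_num [Finset.sum_range_succ, Nat.factorial]

theorem exp_left_bounds {p : ℝ} (h1 : 1.22275 < p) (h2 : p < 1.22276) :
    9.52906 ≤ Real.exp (2 * (p * bracketLeft)) ∧
      Real.exp (2 * (p * bracketLeft)) ≤ 9.52927 := by
  obtain ⟨l, u⟩ := bracketLeft_bounds
  rw [mul_left_comm]
  constructor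
  · refine le_trans ?_ (Real.exp_le_exp.2 (show 4 * 0.56358695 ≤ p * (2 * bracketLeft) from ?_))
    · refine le_exp_four_mul (by norm_num) ?_
      norm_num [Finset.sum_range_succ, Nat.factorial]
    · refine le_trans ?_ (mul_le_mul h1.le l (by norm_num) (by linarith))
      norm_num
  · refine le_trans (Real.exp_le_exp.2 (show p * (2 * bracketLeft) ≤ 4 * 0.5635918 from ?_)) ?_
    · refine le_trans (mul_le_mul h2.le u (by linarith) (by norm_num)) ?_
      norm_num
    · refine exp_four_mul_le (by norm_num) (by norm_num) ?_
      norm_num [Finset.sum_range_succ, Nat.factorial]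

theorem le_exp_right {p : ℝ} (h1 : 1.22275 < p) :
    9.5703 ≤ Real.exp (2 * (p * bracketRight)) := by
  obtain ⟨l, u⟩ := bracketRight_bounds
  rw [mul_left_comm]
  refine le_trans ?_ (Real.exp_le_exp.2 (show 4 * 0.5646676 ≤ p * (2 * bracketRight) from ?_))
  · refine le_exp_four_mul (by norm_num) ?_
    norm_num [Finset.sum_range_succ, Nat.factorial]
  · refine le_trans ?_ (mul_le_mul h1.le l (by norm_num) (by linarith))
    norm_num

theorem tanh_left_bounds {p : ℝ} (h1 : 1.22275 < p) (h2 : p < 1.22276) :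
    0.81004 ≤ Real.tanh (p * bracketLeft) ∧ Real.tanh (p * bracketLeft) ≤ 0.810055 := by
  obtain ⟨l, u⟩ := exp_left_bounds h1 h2
  rw [tanh_eq_one_sub]
  constructor
  · have : 2 / (Real.exp (2 * (p * bracketLeft)) + 1) ≤ 2 / (9.52906 + 1) := by gcongr
    norm_num at *
    linarith
  · have : 2 / (9.52927 + 1) ≤ 2 / (Real.exp (2 * (p * bracketLeft)) + 1) := by gcongr
    norm_num at *
    linarith

theorem le_tanh_right {p : ℝ} (h1 : 1.22275 < p) : 0.81079 ≤ Real.tanh (p * bracketRight) := by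
  have l := le_exp_right h1
  rw [tanh_eq_one_sub]
  have : 2 / (Real.exp (2 * (p * bracketRight)) + 1) ≤ 2 / (9.5703 + 1) := by gcongr
  norm_num at *
  linarith

theorem logRatioDeriv_left_pos {p : ℝ} (h1 : 1.22275 < p) (h2 : p < 1.22276) :
    0 < logRatioDeriv p bracketLeft := by
  obtain ⟨-, ht⟩ := tanh_left_bounds h1 h2
  obtain ⟨hl, -⟩ := arsinh_left_bounds
  rw [logRatioDeriv_eq_tanh, tanh_bracketLeft, sqrt_left]
  have : (1 - (1040 / 1431 : ℝ) ^ 2) / (1769 / 1431 * Real.arsinh (1040 / 1431)) ≤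
      (1 - (1040 / 1431 : ℝ) ^ 2) / (1769 / 1431 * 0.6744548) := by gcongr
  norm_num at *
  linarith

theorem logRatioDeriv_right_neg {p : ℝ} (h1 : 1.22275 < p) :
    logRatioDeriv p bracketRight < 0 := by
  have ht := le_tanh_right h1
  have hl := arsinh_right_le
  have hpos : 0 < Real.arsinh (2241 / 3080) := Real.arsinh_pos_iff.2 (by norm_num)
  rw [logRatioDeriv_eq_tanh, tanh_bracketRight, sqrt_right]
  have : (1 - (2241 / 3080 : ℝ) ^ 2) / (3809 / 3080 * 0.6751288) ≤
      (1 - (2241 / 3080 : ℝ) ^ 2) / (3809 / 3080 * Real.arsinh (2241 / 3080)) := by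
    gcongr
  norm_num at *
  linarith

theorem logRatioDeriv_le_of_mem {p s : ℝ} (h1 : 1.22275 < p) (h2 : p < 1.22276)
    (hl : bracketLeft ≤ s) (hr : s ≤ bracketRight) : logRatioDeriv p s ≤ 0.003 := by
  have h0 : 0 < bracketLeft := by linarith [bracketLeft_bounds.1]
  refine (logRatioDeriv_le (by linarith) h0 hl hr).trans ?_
  obtain ⟨ht, -⟩ := tanh_left_bounds h1 h2
  have hl := arsinh_right_le
  have hpos : 0 < Real.arsinh (2241 / 3080) := Real.arsinh_pos_iff.2 (by norm_num)
  rw [tanh_bracketLeft, tanh_bracketRight, sqrt_right]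
  have : (1 - (2241 / 3080 : ℝ) ^ 2) / (3809 / 3080 * 0.6751288) ≤
      (1 - (2241 / 3080 : ℝ) ^ 2) / (3809 / 3080 * Real.arsinh (2241 / 3080)) := by
    gcongr
  norm_num at *
  linarith

theorem log_cosh_left_bounds {p : ℝ} (h1 : 1.22275 < p) (h2 : p < 1.22276) :
    0.533818 ≤ Real.log (Real.cosh (p * bracketLeft)) ∧
      Real.log (Real.cosh (p * bracketLeft)) ≤ 0.5338286 := by
  obtain ⟨l, u⟩ := exp_left_bounds h1 h2
  rw [log_cosh_eq_half_log]
  generalize Real.exp (2 * (p * bracketLeft)) = E at *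
  have hE : 0 < E := by linarith
  -- `E + 1 / E` is increasing for `1 ≤ E`
  have g1 : 9.52906 + 1 / 9.52906 ≤ E + 1 / E := by
    have : E + 1 / E - (9.52906 + 1 / 9.52906) = (E - 9.52906) * (1 - 1 / (9.52906 * E)) := by
      field_simp; ring
    have h : 1 / (9.52906 * E) ≤ 1 := by rw [div_le_one (by positivity)]; linarith
    nlinarith [mul_nonneg (sub_nonneg.2 l) (sub_nonneg.2 h)]
  have g2 : 1 / E ≤ 1 / 9.52906 := by gcongr
  constructor
  · have := Real.log_le_log (x := 2.9085) (y := (E + 1 / E + 2) / 4) (by norm_num)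
      (by norm_num at *; linarith)
    have h3 : 4 * 0.266909 ≤ Real.log 2.9085 := by
      refine four_mul_le_log (by norm_num) (by norm_num) ?_
      norm_num [Finset.sum_range_succ, Nat.factorial]
    norm_num at *
    linarith
  · have := Real.log_le_log (x := (E + 1 / E + 2) / 4) (y := 2.908554) (by positivity)
      (by norm_num at *; linarith)
    have h3 : Real.log 2.908554 ≤ 4 * 0.2669143 := by
      refine log_le_four_mul (by norm_num) (by norm_num) ?_
      norm_num [Finset.sum_range_succ, Nat.factorial]
    norm_num at *
    linarith

theorem logRatio_left_bounds {p : ℝ} (h1 : 1.22275 < p) (h2 : p < 1.22276) :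
    0.0137 ≤ logRatio p bracketLeft ∧ logRatio p bracketLeft ≤ 0.01372 := by
  obtain ⟨l, u⟩ := log_cosh_left_bounds h1 h2
  obtain ⟨al, au⟩ := arsinh_left_bounds
  have hp : 0 < p := by linarith
  have b1 : Real.log (Real.cosh (p * bracketLeft)) / p ≤ 0.5338286 / 1.22275 := by gcongr
  have b2 : 0.533818 / 1.22276 ≤ Real.log (Real.cosh (p * bracketLeft)) / p := by gcongr
  have hA : 0 < Real.arsinh (1040 / 1431) := by linarith
  have e : Real.log (Real.sinh bracketLeft) - Real.log (Real.arsinh (1040 / 1431)) =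
      Real.log (1081600 / 966161 / Real.arsinh (1040 / 1431) ^ 2) / 2 := by
    have : (1081600 / 966161 : ℝ) = Real.sinh bracketLeft ^ 2 := by
      rw [bracketLeft, Real.sinh_artanh (by norm_num), div_pow, Real.sq_sqrt (by norm_num)]
      norm_num
    have hS : Real.sinh bracketLeft ≠ 0 := by
      intro h
      rw [h] at this
      norm_num at this
    rw [this, Real.log_div (by positivity) (by positivity), Real.log_pow, Real.log_pow]
    push_cast
    ring
  rw [logRatio, tanh_bracketLeft, e]
  constructor
  · have : 4 * 0.2251414 ≤ Real.log (1081600 / 966161 / Real.arsinh (1040 / 1431) ^ 2) := by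
      refine le_trans (four_mul_le_log (z := 1081600 / 966161 / 0.6744552 ^ 2)
        (by norm_num) (by norm_num) ?_) (Real.log_le_log (by norm_num) (by gcongr))
      norm_num [Finset.sum_range_succ, Nat.factorial]
    norm_num at *
    linarith
  · have : Real.log (1081600 / 966161 / Real.arsinh (1040 / 1431) ^ 2) ≤ 4 * 0.225142 := by
      refine le_trans (Real.log_le_log (by positivity) ?_) (log_le_four_mul
        (z := 1081600 / 966161 / 0.6744548 ^ 2) (by norm_num) (by norm_num) ?_)
      · gcongr
      · norm_num [Finset.sum_range_succ, Nat.factorial]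
    norm_num at *
    linarith

/-- A critical point lies in the bracket, where the derivative is so small that the value differs
from the one at the left end by less than the required precision. -/
theorem logRatio_le_of_critical {p s : ℝ} (h1 : 1.22275 < p) (h2 : p < 1.22276) (hs : 0 < s)
    (hcrit : logRatioDeriv p s = 0) : logRatio p s ≤ 0.01373 := by
  have hcross := crossesDown_logRatioDeriv h1 h2
  have hleft := logRatioDeriv_left_pos h1 h2
  have hright := logRatioDeriv_right_neg h1
  have h0 : 0 < bracketLeft := by linarith [bracketLeft_bounds.1]
  have h0' : 0 < bracketRight := by linarith [bracketRight_bounds.1]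
  have hl : bracketLeft < s := by
    by_contra! h
    rcases h.lt_or_eq with h | h
    · linarith [hcross _ _ hs h hcrit.le]
    · rw [h] at hcrit; linarith
  have hr : s < bracketRight := by
    by_contra! h
    rcases h.lt_or_eq with h | h
    · linarith [hcross _ _ h0' h hright.le]
    · rw [← h] at hcrit; linarith
  obtain ⟨ξ, hξ, hm⟩ := exists_hasDerivAt_eq_slope (logRatio p) (logRatioDeriv p) hl
    (fun x hx => (hasDerivAt_logRatio (by linarith)
      (h0.trans_le hx.1)).continuousAt.continuousWithinAt)
    (fun x hx => hasDerivAt_logRatio (by linarith) (h0.trans hx.1))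
  have hb := logRatioDeriv_le_of_mem h1 h2 hξ.1.le (hξ.2.trans hr).le
  rw [hm, div_le_iff₀ (by linarith)] at hb
  have := (logRatio_left_bounds h1 h2).2
  have := bracketLeft_bounds.1
  have := bracketRight_bounds.2
  norm_num at *
  linarith

/-! ### The maximum of the logarithmic ratio and the sharp inequalities -/

theorem exists_max_logRatio {p : ℝ} (h1 : 1.22275 < p) (h2 : p < 1.22276) :
    ∃ m, 0 < m ∧ logRatioDeriv p m = 0 ∧ bracketLeft < m ∧
      StrictMonoOn (logRatio p) (Ioc 0 m) ∧ StrictAntiOn (logRatio p) (Ici m) := by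
  have hp : p ≠ 0 := by linarith
  have hcross := crossesDown_logRatioDeriv h1 h2
  have h0 : 0 < bracketLeft := by linarith [bracketLeft_bounds.1]
  have hlr : bracketLeft ≤ bracketRight := by
    linarith [bracketLeft_bounds.2, bracketRight_bounds.1]
  obtain ⟨m, hm, hm0⟩ := exists_hasDerivWithinAt_eq_of_lt_of_gt hlr
    (fun x hx => (hasDerivAt_logRatio hp (h0.trans_le hx.1)).hasDerivWithinAt)
    (logRatioDeriv_left_pos h1 h2) (logRatioDeriv_right_neg h1)
  have hmpos : 0 < m := h0.trans hm.1
  refine ⟨m, hmpos, hm0, hm.1, ?_, ?_⟩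
  · refine strictMonoOn_of_deriv_pos (convex_Ioc 0 m)
      (fun x hx => (hasDerivAt_logRatio hp hx.1).continuousAt.continuousWithinAt) fun x hx => ?_
    rw [interior_Ioc] at hx
    rw [(hasDerivAt_logRatio hp hx.1).deriv]
    by_contra! h
    linarith [hcross x m hx.1 hx.2 h]
  · refine strictAntiOn_of_deriv_neg (convex_Ici m)
      (fun x hx => (hasDerivAt_logRatio hp
        (hmpos.trans_le hx)).continuousAt.continuousWithinAt) fun x hx => ?_
    rw [interior_Ici] at hx
    rw [(hasDerivAt_logRatio hp (hmpos.trans hx)).deriv]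
    exact hcross m x hmpos hx hm0.le

theorem logRatio_lt_of_ne {F : ℝ → ℝ} {m s : ℝ} (hmono : StrictMonoOn F (Ioc 0 m))
    (hanti : StrictAntiOn F (Ici m)) (hs : 0 < s) (hne : s ≠ m) : F s < F m := by
  rcases lt_or_gt_of_ne hne with h | h
  · exact hmono ⟨hs, h.le⟩ ⟨hs.trans h, le_rfl⟩ h
  · exact hanti self_mem_Ici h.le h

theorem log_log_pos : 0 < Real.log (Real.log (3 + 2 * √2)) := by
  linarith [log_log_bounds.1]

theorem tendsto_logRatio_sharpOrder_atTop : Tendsto (logRatio sharpOrder) atTop (𝓝 0) := by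
  have h := tendsto_logRatio_atTop (p := sharpOrder) (by linarith [sharpOrder_bounds.1])
  have := log_log_pos
  have := Real.log_pos one_lt_two
  rwa [sharpOrder, div_div_cancel₀ (by positivity), sub_self] at h

theorem logRatio_sharpOrder_pos {s : ℝ} (hs : 0 < s) : 0 < logRatio sharpOrder s := by
  obtain ⟨m, hm, -, -, hmono, hanti⟩ := exists_max_logRatio sharpOrder_bounds.1 sharpOrder_bounds.2
  rcases le_total s m with h | h
  · refine lt_of_le_of_lt (b := logRatio sharpOrder (s / 2)) ?_
      (hmono ⟨by linarith, by linarith⟩ ⟨hs, h⟩ (by linarith))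
    refine le_of_tendsto (tendsto_logRatio_zero sharpOrder) ?_
    filter_upwards [Ioo_mem_nhdsGT (show (0 : ℝ) < s / 2 by linarith)] with z hz
    exact (hmono ⟨hz.1, by linarith [hz.2]⟩ ⟨by linarith, by linarith⟩ hz.2).le
  · refine lt_of_le_of_lt (b := logRatio sharpOrder (s + 1)) ?_
      (hanti h (show m ≤ s + 1 by linarith) (by linarith))
    refine le_of_tendsto tendsto_logRatio_sharpOrder_atTop ?_
    filter_upwards [eventually_gt_atTop (s + 1)] with z hz
    exact (hanti (show m ≤ s + 1 by linarith) (show m ≤ z by linarith) hz).le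

theorem powerMean_lt_neumanSandorMean_iff (p : ℝ) :
    (∀ a b : ℝ, 0 < a → 0 < b → a ≠ b → powerMean p a b < neumanSandorMean a b) ↔
      p ≤ sharpOrder := by
  have hp0 : 0 < sharpOrder := by linarith [sharpOrder_bounds.1]
  rw [forall_ne_iff (fun a b h => by rwa [powerMean_comm, neumanSandorMean_comm])]
  constructor
  · intro h
    by_contra! hlt
    have hp : 0 < p := hp0.trans hlt
    have hneg : Real.log 2 / p - Real.log (Real.log (3 + 2 * √2)) < 0 := by
      rw [sharpOrder, div_lt_iff₀ log_log_pos, mul_comm, ← div_lt_iff₀ hp] at hlt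
      linarith
    obtain ⟨s, hs, hs0⟩ := (((tendsto_logRatio_atTop hp).eventually_lt_const hneg).and
      (eventually_gt_atTop 0)).exists
    have h' := h 1 s one_pos hs0
    rw [neumanSandorMean_eq hp.ne' one_pos hs0] at h'
    have := mul_le_of_le_one_left (powerMean_pos hp.ne' one_pos s).le
      (Real.exp_le_one_iff.2 hs.le)
    linarith
  · intro hp c s hc hs
    refine (powerMean_le_powerMean hp0 hp hc s).trans_lt ?_
    rw [neumanSandorMean_eq hp0.ne' hc hs]
    exact lt_mul_of_one_lt_left (powerMean_pos hp0.ne' hc s)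
      (Real.one_lt_exp_iff.2 (logRatio_sharpOrder_pos hs))

theorem isGreatest_lower_constant :
    IsGreatest {α : ℝ | ∀ a b : ℝ, 0 < a → 0 < b → a ≠ b →
      α * powerMean sharpOrder a b < neumanSandorMean a b} 1 := by
  have hp0 : sharpOrder ≠ 0 := by linarith [sharpOrder_bounds.1]
  constructor
  · simpa using (powerMean_lt_neumanSandorMean_iff sharpOrder).2 le_rfl
  · intro α hα
    rw [mem_ofPred_eq,
      forall_ne_iff (fun a b h => by rwa [powerMean_comm, neumanSandorMean_comm])] at hα
    have hlim := tendsto_logRatio_sharpOrder_atTop.rexp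
    rw [Real.exp_zero] at hlim
    refine ge_of_tendsto hlim ?_
    filter_upwards [eventually_gt_atTop 0] with s hs
    have h := hα 1 s one_pos hs
    rw [neumanSandorMean_eq hp0 one_pos hs] at h
    exact (lt_of_mul_lt_mul_right h (powerMean_pos hp0 one_pos s).le).le

theorem exp_max_bounds {x : ℝ} (h1 : 0.0137 ≤ x) (h2 : x ≤ 0.01373) :
    |Real.exp x - 1.0138| < 0.00005 := by
  have hl := (Real.quadratic_le_exp_of_nonneg (x := 0.0137) (by norm_num)).trans
    (Real.exp_le_exp.2 h1)
  have hu := (Real.exp_le_exp.2 h2).trans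
    (Real.exp_bound' (by norm_num) (by norm_num) (n := 3) (by norm_num))
  norm_num [Finset.sum_range_succ, Nat.factorial] at hl hu
  rw [abs_lt]
  norm_num
  constructor <;> linarith

theorem theorem2 :
    (∀ p : ℝ,
      (∀ a b : ℝ, 0 < a → 0 < b → a ≠ b → powerMean p a b < neumanSandorMean a b) ↔
        p ≤ sharpOrder) ∧
    |sharpOrder - 1.2228| < 0.00005 ∧
    IsGreatest
      {α : ℝ | ∀ a b : ℝ, 0 < a → 0 < b → a ≠ b →
        α * powerMean sharpOrder a b < neumanSandorMean a b} 1 ∧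
    ∃ β₂ : ℝ,
      |β₂ - 1.0138| < 0.00005 ∧
      IsLeast
        {β : ℝ | ∀ a b : ℝ, 0 < a → 0 < b → a ≠ b →
          neumanSandorMean a b ≤ β * powerMean sharpOrder a b} β₂ ∧
      ∃ x₀ : ℝ, 0 < x₀ ∧ x₀ < 1 ∧
        ∀ a b : ℝ, 0 < a → 0 < b → a ≠ b →
          (neumanSandorMean a b = β₂ * powerMean sharpOrder a b ↔ b = x₀ * a ∨ a = x₀ * b) := by
  obtain ⟨h1, h2⟩ := sharpOrder_bounds
  have hp0 : sharpOrder ≠ 0 := by linarith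
  obtain ⟨m, hm, hcrit, hlm, hmono, hanti⟩ := exists_max_logRatio h1 h2
  have hlt {s : ℝ} (hs : 0 < s) (hne : s ≠ m) := logRatio_lt_of_ne hmono hanti hs hne
  refine ⟨powerMean_lt_neumanSandorMean_iff, ?_, isGreatest_lower_constant,
    Real.exp (logRatio sharpOrder m), ?_, ⟨?_, ?_⟩, Real.exp (-(2 * m)), Real.exp_pos _, ?_, ?_⟩
  · rw [abs_lt]
    norm_num at *
    constructor <;> linarith
  · refine exp_max_bounds ?_ (logRatio_le_of_critical h1 h2 hm hcrit)
    refine (logRatio_left_bounds h1 h2).1.trans (hlt ?_ hlm.ne).le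
    linarith [bracketLeft_bounds.1]
  · rw [mem_ofPred_eq,
      forall_ne_iff (fun a b h => by rwa [powerMean_comm, neumanSandorMean_comm])]
    intro c s hc hs
    rw [neumanSandorMean_eq hp0 hc hs]
    refine mul_le_mul_of_nonneg_right (Real.exp_le_exp.2 ?_) (powerMean_pos hp0 hc s).le
    rcases eq_or_ne s m with rfl | hne
    · exact le_rfl
    · exact (hlt hs hne).le
  · intro β hβ
    rw [mem_ofPred_eq,
      forall_ne_iff (fun a b h => by rwa [powerMean_comm, neumanSandorMean_comm])] at hβ
    have h := hβ 1 m one_pos hm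
    rw [neumanSandorMean_eq hp0 one_pos hm] at h
    exact le_of_mul_le_mul_right h (powerMean_pos hp0 one_pos m)
  · rw [Real.exp_lt_one_iff]
    linarith
  · rw [forall_ne_iff (fun a b h => by rwa [powerMean_comm, neumanSandorMean_comm, or_comm])]
    intro c s hc hs
    rw [neumanSandorMean_eq hp0 hc hs, mul_left_inj' (powerMean_pos hp0 hc s).ne', Real.exp_eq_exp,
      mul_left_comm, mul_right_inj' hc.ne', mul_left_comm, mul_right_inj' hc.ne',
      ← Real.exp_add, ← Real.exp_add, Real.exp_eq_exp, Real.exp_eq_exp]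
    constructor
    · intro h
      by_contra! hcon
      exact (hlt hs fun h => hcon.1 (by rw [h]; ring)).ne h
    · rintro (h | h)
      · rw [show s = m by linarith]
      · linarith
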